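/- Let $m$ be a product of distinct odd primes (the empty product $m=1$ is allowed), and let $\varphi$ denote Euler's totient function. Then the set of real numbers $$\{\pi\}\cup\left\{\arccos\frac{1}{\varphi(r)} : r \text{ a positive divisor of } m \text{ with } r>3\right\}$$ is linearly independent over $\mathbb{Q}$. (This is a set: if two divisors $r\neq s$ of $m$ satisfy $\varphi(r)=\varphi(s)$, the common value $\arccos\frac1{\varphi(r)}$ occurs in it only once.) -/

import Mathlib

open Polynomial

/-! ### Powers of norm-one elements of `ℤ√d` -/

namespace Zsqrtd

variable {d : ℤ} {ε : ℤ√d}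

/-! For odd r > 3 the number φ(r) is even and at least 4. Put z = exp(i arccos(1/n)), so that z +
1/z = 2/n. Exponentiating turns a rational relation, after clearing denominators, into a
multiplicative relation among such z for distinct even n ≥ 4, and these are shown to be
multiplicatively independent.

Since nz - 1 is a square root of 1 - n², Galois conjugation sends each z to z or 1/z. Averaging the
relation against the sign character of one z keeps exactly the terms whose n² - 1 lies in the same
square class (`exists_relation_of_isGalois`). These n are then x-coordinates of solutions of one
Pell equation, that is, real parts of powers ε^k of a fundamental solution, and evenness of n forces
k to be odd.

For the largest exponent k > 1, a Zsigmondy argument on the norm of Φ_{4k}(ε) gives an odd prime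
dividing that n and no other (`exists_primitive_prime_dvd_re_pow`). Such a prime survives in the
denominators of the powers of z, so its exponent vanishes (`exponent_eq_zero_of_prime_dvd`). If only
one term remains, Niven's theorem applies. -/

theorem pow_add_star_pow (ε : ℤ√d) (k : ℕ) :
    ε ^ k + star ε ^ k = ((2 * (ε ^ k).re : ℤ) : ℤ√d) := by
  rw [← star_pow]
  generalize ε ^ k = η
  ext
  · simp [two_mul]
  · simp

theorem mul_star_of_norm_eq_one (hε : ε.norm = 1) : ε * star ε = 1 := by
  rw [← norm_eq_mul_conj, hε, Int.cast_one]

theorem norm_pow_eq_one (hε : ε.norm = 1) (k : ℕ) : (ε ^ k).norm = 1 := by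
  have := map_pow (normMonoidHom (d := d)) ε k
  simp only [normMonoidHom, MonoidHom.coe_mk, OneHom.coe_mk] at this
  rw [this, hε, one_pow]

theorem re_pow_add_two (hε : ε.norm = 1) (k : ℕ) :
    (ε ^ (k + 2)).re = 2 * ε.re * (ε ^ (k + 1)).re - (ε ^ k).re := by
  have h := norm_def ε
  rw [hε] at h
  simp only [pow_succ, re_mul, im_mul]
  linear_combination (ε ^ k).re * h

theorem re_sq (hε : ε.norm = 1) : (ε ^ 2).re = 2 * ε.re ^ 2 - 1 := by
  have := re_pow_add_two hε 0
  simp at this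
  rw [this]; ring

theorem odd_re_pow_two_mul (hε : ε.norm = 1) (k : ℕ) : Odd (ε ^ (2 * k)).re := by
  rw [mul_comm, pow_mul, re_sq (norm_pow_eq_one hε k)]
  exact ⟨(ε ^ k).re ^ 2 - 1, by ring⟩

theorem even_re_of_even_re_pow (hε : ε.norm = 1) (j : ℕ) (h : Even (ε ^ (2 * j + 1)).re) :
    Even ε.re := by
  induction j with
  | zero => simpa using h
  | succ j ih =>
    apply ih
    rw [show 2 * (j + 1) + 1 = (2 * j + 1) + 2 by ring, re_pow_add_two hε] at h
    rw [Int.even_sub, mul_assoc] at h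
    exact h.1 (even_two_mul _)

/-- The real part of the `k`-th power, `k` odd, of a norm-one `ε` is `ε.re` times a cofactor that is
`± k` modulo `ε.re ^ 2`. -/
theorem exists_re_pow_odd_eq (hε : ε.norm = 1) (j : ℕ) :
    ∃ h t : ℤ, (ε ^ (2 * j + 1)).re = ε.re * h ∧
      h = (-1) ^ j * (2 * j + 1) + ε.re ^ 2 * t := by
  induction j using Nat.twoStepInduction with
  | zero => exact ⟨1, 0, by simp, by simp⟩
  | one =>
    refine ⟨4 * ε.re ^ 2 - 3, 4, ?_, by push_cast; ring⟩
    have := re_pow_add_two hε 1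
    rw [re_sq hε] at this
    simp only [mul_one, Nat.reduceAdd] at this ⊢
    rw [this, pow_one]; ring
  | more j ih₁ ih₂ =>
    obtain ⟨h₁, t₁, e₁, f₁⟩ := ih₁
    obtain ⟨h₂, t₂, e₂, f₂⟩ := ih₂
    refine ⟨2 * (2 * ε.re ^ 2 - 1) * h₂ - h₁, 4 * h₂ - 2 * t₂ - t₁, ?_, ?_⟩
    · have a₁ := re_pow_add_two hε (2 * j + 1)
      have a₂ := re_pow_add_two hε (2 * j + 2)
      have a₃ := re_pow_add_two hε (2 * j + 3)
      rw [show 2 * (j + 1) + 1 = 2 * j + 1 + 2 by ring] at e₂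
      rw [show 2 * (j + 2) + 1 = 2 * j + 3 + 2 by ring]
      linear_combination a₃ + 2 * ε.re * a₂ + (4 * ε.re ^ 2 - 2) * e₂ - e₁ + a₁
    · push_cast at f₁ f₂ ⊢
      linear_combination (-2) * f₂ - f₁

end Zsqrtd

/-! ### Cyclotomic values and primitive prime divisors -/

/-- If `k'` is a proper divisor of the odd number `k`, then `X ^ (2 * k) + 1` is divisible by
`(X ^ (2 * k') + 1) * cyclotomic (4 * k)`. -/
theorem Polynomial.exists_X_pow_add_one_eq_mul_cyclotomic {k k' : ℕ} (hk : Odd k) (hdvd : k' ∣ k)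
    (hlt : k' < k) : ∃ H : ℤ[X],
      (X : ℤ[X]) ^ (2 * k) + 1 = (X ^ (2 * k') + 1) * (cyclotomic (4 * k) ℤ * H) := by
  obtain ⟨q, rfl⟩ := hdvd
  have hq : Odd q := (Nat.odd_mul.1 hk).2
  have hk0 : 0 < 4 * (k' * q) := by omega
  have hk'0 : 0 < k' := by rcases Nat.eq_zero_or_pos k' with rfl | h <;> simp_all
  obtain ⟨G, hG⟩ : (X : ℤ[X]) ^ (2 * k') + 1 ∣ X ^ (2 * (k' * q)) + 1 := by
    have := Odd.add_dvd_pow_add_pow ((X : ℤ[X]) ^ (2 * k')) 1 hq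
    rwa [one_pow, ← pow_mul, mul_assoc] at this
  have hζ := Complex.isPrimitiveRoot_exp (4 * (k' * q)) hk0.ne'
  set ζ := Complex.exp (2 * Real.pi * Complex.I / (4 * (k' * q) : ℕ)) with hζdef
  -- A primitive root ζ of order 4k'q is a zero of X^(2k'q) + 1 but not of X^(2k') + 1, hence a zero
  -- of G.
  suffices h : cyclotomic (4 * (k' * q)) ℤ ∣ G by
    obtain ⟨H, rfl⟩ := h
    exact ⟨H, hG⟩
  rw [cyclotomic_eq_minpoly hζ hk0]
  apply minpoly.isIntegrallyClosed_dvd (hζ.isIntegral hk0)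
  have h1 : ζ ^ (2 * (k' * q)) ≠ 1 := fun h => by
    have := Nat.le_of_dvd (by omega) (hζ.dvd_of_pow_eq_one _ h)
    omega
  have h2 : ζ ^ (2 * (k' * q)) = -1 := by
    have := hζ.pow_eq_one
    rw [show 4 * (k' * q) = 2 * (k' * q) * 2 by ring, pow_mul] at this
    rcases mul_eq_zero.1 (show (ζ ^ (2 * (k' * q)) - 1) * (ζ ^ (2 * (k' * q)) + 1) = 0 by
      linear_combination this) with h | h
    · exact absurd (sub_eq_zero.1 h) h1
    · exact eq_neg_of_add_eq_zero_left h
  have h3 : ζ ^ (2 * k') + 1 ≠ 0 := fun h => by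
    have h' : ζ ^ (4 * k') = 1 := by
      rw [show 4 * k' = 2 * k' * 2 by ring, pow_mul, eq_neg_of_add_eq_zero_left h]; norm_num
    have := Nat.le_of_dvd (by omega) (hζ.dvd_of_pow_eq_one _ h')
    omega
  have h4 := congrArg (aeval ζ) hG
  simp only [map_add, map_pow, aeval_X, map_one, map_mul, h2, neg_add_cancel] at h4
  exact (mul_eq_zero.1 h4.symm).resolve_left h3

namespace Zsqrtd

variable {d : ℤ} {ε : ℤ√d}

theorem norm_pow_two_mul_add_one (hε : ε.norm = 1) (k : ℕ) :
    (ε ^ (2 * k) + 1).norm = 4 * (ε ^ k).re ^ 2 := by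
  have h : ε ^ (2 * k) + 1 = ε ^ k * ((2 * (ε ^ k).re : ℤ) : ℤ√d) := by
    rw [← pow_add_star_pow, mul_add, ← mul_pow ε (star ε), mul_star_of_norm_eq_one hε]
    ring
  rw [h, norm_mul, norm_pow_eq_one hε, norm_intCast]
  ring

/-- Evaluate the polynomial factorization at ε and take norms; the factors 4 on both sides cancel.
-/
theorem norm_cyclotomic_mul_re_pow_sq_dvd (hε : ε.norm = 1) {k k' : ℕ} (hk : Odd k)
    (hdvd : k' ∣ k) (hlt : k' < k) :
    (aeval ε (cyclotomic (4 * k) ℤ)).norm * (ε ^ k').re ^ 2 ∣ (ε ^ k).re ^ 2 := by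
  obtain ⟨H, hH⟩ := exists_X_pow_add_one_eq_mul_cyclotomic hk hdvd hlt
  have h := congrArg (fun P => (aeval ε P).norm) hH
  simp only [map_add, map_pow, aeval_X, map_one, map_mul, norm_mul,
    norm_pow_two_mul_add_one hε] at h
  exact ⟨(aeval ε H).norm, by linarith⟩

/-- A ring homomorphism from `ℤ√d` to an algebraically closed field. -/
theorem exists_ringHom (d : ℤ) (K : Type*) [Field K] [IsAlgClosed K] : Nonempty (ℤ√d →+* K) := by
  obtain ⟨r, hr⟩ := IsAlgClosed.exists_pow_nat_eq (d : K) (n := 2) (by norm_num)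
  exact ⟨lift ⟨r, by rw [← sq, hr]⟩⟩

theorem star_aeval (ε : ℤ√d) (P : ℤ[X]) : star (aeval ε P) = aeval (star ε) P := by
  have := hom_eval₂ P (algebraMap ℤ (ℤ√d)) (starRingEnd (ℤ√d)) ε
  rw [aeval_def, aeval_def, ← starRingEnd_apply, this, starRingEnd_apply]
  congr 1

theorem map_norm_aeval {K : Type*} [Field K] (f : ℤ√d →+* K) (ε : ℤ√d) (P : ℤ[X]) :
    (((aeval ε P).norm : ℤ) : K) =
      (P.map (Int.castRingHom K)).eval (f ε) * (P.map (Int.castRingHom K)).eval (f (star ε)) := by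
  have h : ∀ a : ℤ√d, f (aeval a P) = (P.map (Int.castRingHom K)).eval (f a) := fun a => by
    rw [aeval_def, hom_eval₂, eval_map]
    congr 1
    exact RingHom.ext_int _ _
  rw [← h, ← h, ← map_mul, ← star_aeval, ← norm_eq_mul_conj, map_intCast]

/-- In characteristic p, vanishing of re(ε^j) makes the image u of ε satisfy u^(4j) = 1. A zero of
Φ_{4k} has exact order 4k when p does not divide 4k, which exceeds 4j. -/
theorem not_dvd_re_pow_of_dvd_norm_cyclotomic (hε : ε.norm = 1) {k p : ℕ} (hp : p.Prime)
    (hpk : ¬ p ∣ 4 * k) (hpN : (p : ℤ) ∣ (aeval ε (cyclotomic (4 * k) ℤ)).norm) {j : ℕ}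
    (hj0 : 0 < j) (hjk : j < k) : ¬ (p : ℤ) ∣ (ε ^ j).re := by
  intro hpj
  have : Fact p.Prime := ⟨hp⟩
  let K := AlgebraicClosure (ZMod p)
  have : CharP K p := charP_of_injective_algebraMap (algebraMap (ZMod p) K).injective p
  obtain ⟨f⟩ := exists_ringHom d K
  have hne : NeZero ((4 * k : ℕ) : K) := ⟨by rwa [Ne, CharP.cast_eq_zero_iff K p]⟩
  have huv : f ε * f (star ε) = 1 := by
    rw [← map_mul, mul_star_of_norm_eq_one hε, map_one]
  have hsum : f ε ^ j + f (star ε) ^ j = 0 := by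
    rw [← map_pow, ← map_pow, ← map_add, pow_add_star_pow, map_intCast,
      CharP.intCast_eq_zero_iff K p]
    exact hpj.mul_left 2
  have key : ∀ u v : K, u * v = 1 → u ^ j + v ^ j = 0 →
      ((cyclotomic (4 * k) ℤ).map (Int.castRingHom K)).eval u ≠ 0 := by
    intro u v huv hs h0
    rw [map_cyclotomic] at h0
    have hu : IsPrimitiveRoot u (4 * k) := isRoot_cyclotomic_iff.1 h0
    have h4 : u ^ (4 * j) = 1 := by
      have h1 : u ^ j * v ^ j = 1 := by rw [← mul_pow, huv, one_pow]
      have h2 : (u ^ j) ^ 2 = -1 := by linear_combination u ^ j * hs - h1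
      rw [show 4 * j = j * 2 * 2 by ring, pow_mul, pow_mul, h2]; norm_num
    have := Nat.le_of_dvd (by omega) (hu.dvd_of_pow_eq_one _ h4)
    omega
  have hN := (CharP.intCast_eq_zero_iff K p _).2 hpN
  rw [map_norm_aeval f] at hN
  rcases mul_eq_zero.1 hN with h | h
  · exact key _ _ huv hsum h
  · exact key _ _ (by rwa [mul_comm]) (by rwa [add_comm]) h

/-- The norm is a product over primitive n-th roots μ of (ε - μ)(star ε - μ) = 1 + μ² - 2 re(ε) μ,
and each factor has modulus at least 2 re(ε) - 2. -/
theorem le_abs_norm_cyclotomic (hε : ε.norm = 1) (hre : 1 ≤ ε.re) {n : ℕ} (hn : 0 < n) :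
    (2 * ε.re - 2) ^ n.totient ≤ |(aeval ε (cyclotomic n ℤ)).norm| := by
  obtain ⟨f⟩ := exists_ringHom d ℂ
  have huv : f ε * f (star ε) = 1 := by
    rw [← map_mul, mul_star_of_norm_eq_one hε, map_one]
  have hsum : f ε + f (star ε) = 2 * ε.re := by
    have := pow_add_star_pow ε 1
    simp only [pow_one] at this
    rw [← map_add, this, map_intCast]; push_cast; rfl
  have hζ := Complex.isPrimitiveRoot_exp n hn.ne'
  have h := map_norm_aeval f ε (cyclotomic n ℤ)
  rw [map_cyclotomic, cyclotomic_eq_prod_X_sub_primitiveRoots hζ, eval_prod, eval_prod,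
    ← Finset.prod_mul_distrib] at h
  have hre' : (1 : ℝ) ≤ ε.re := by exact_mod_cast hre
  have hcast : ((2 * ε.re - 2 : ℝ)) ^ n.totient ≤ |((aeval ε (cyclotomic n ℤ)).norm : ℝ)| := by
    rw [← Complex.norm_intCast, h, norm_prod, ← hζ.card_primitiveRoots]
    rw [← Finset.prod_const]
    apply Finset.prod_le_prod
    · intro _ _; linarith
    · intro μ hμ
      have hμ1 : ‖μ‖ = 1 := ((mem_primitiveRoots hn).1 hμ).norm'_eq_one hn.ne'
      simp only [eval_sub, eval_X, eval_C]
      have e : (f ε - μ) * (f (star ε) - μ) = (1 + μ ^ 2) - (2 * ε.re : ℂ) * μ := by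
        linear_combination huv - μ * hsum
      rw [e, norm_sub_rev]
      refine le_trans ?_ (norm_sub_norm_le _ _)
      have e1 : ‖(2 * ε.re : ℂ) * μ‖ = 2 * ε.re := by
        rw [_root_.norm_mul, hμ1, _root_.norm_mul, Complex.norm_intCast,
          abs_of_nonneg (by linarith)]
        simp
      have e2 : ‖1 + μ ^ 2‖ ≤ 2 := by
        refine (norm_add_le _ _).trans ?_
        rw [norm_pow, hμ1]; norm_num
      linarith
  exact_mod_cast hcast

/-- If p² divided h, Frobenius would give (2 re ε)^p ≡ 2 re(ε^p) ≡ 0 mod p, so p divides re ε. But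
then h ≡ ±p mod p². -/
theorem not_sq_dvd_cofactor {p : ℕ} (hp : p.Prime) (hp2 : Odd p) (hε : ε.norm = 1) :
    ∃ h : ℤ, (ε ^ p).re = ε.re * h ∧ ¬ (p : ℤ) ^ 2 ∣ h := by
  obtain ⟨j, hj⟩ := hp2
  obtain ⟨h, t, e, f⟩ := exists_re_pow_odd_eq hε j
  rw [← hj] at e
  refine ⟨h, e, fun hdvd => ?_⟩
  have hpZ : Prime (p : ℤ) := Nat.prime_iff_prime_int.1 hp
  have hp2 : ¬ (p : ℤ) ∣ 2 := fun h2 => by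
    have := Nat.le_of_dvd (by norm_num) (show p ∣ 2 by exact_mod_cast h2)
    have := hp.two_le
    omega
  have hpre : (p : ℤ) ∣ ε.re := by
    have h1 : (p : ℤ) ∣ (ε ^ p).re := e ▸ (((dvd_pow_self _ two_ne_zero).trans hdvd).mul_left _)
    have : Fact p.Prime := ⟨hp⟩
    let K := AlgebraicClosure (ZMod p)
    have : CharP K p := charP_of_injective_algebraMap (algebraMap (ZMod p) K).injective p
    obtain ⟨g⟩ := exists_ringHom d K
    have h2 : ((2 * (ε ^ p).re : ℤ) : K) = ((2 * ε.re : ℤ) : K) ^ p := by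
      have a := congrArg g (pow_add_star_pow ε p)
      have b := congrArg g (pow_add_star_pow ε 1)
      simp only [pow_one, map_add, map_pow, map_intCast] at a b
      rw [← a, ← b, add_pow_char]
    rw [(CharP.intCast_eq_zero_iff K p _).2 (h1.mul_left 2)] at h2
    have h3 := (CharP.intCast_eq_zero_iff K p _).1 (pow_eq_zero_iff hp.ne_zero |>.1 h2.symm)
    exact (hpZ.dvd_or_dvd h3).resolve_left hp2
  have h4 : (p : ℤ) ^ 2 ∣ (-1) ^ j * (p : ℤ) := by
    have : (-1) ^ j * (p : ℤ) = h - ε.re ^ 2 * t := by rw [f, hj]; push_cast; ring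
    rw [this]
    exact dvd_sub hdvd ((pow_dvd_pow_of_dvd hpre 2).mul_right _)
  have h5 : (p : ℤ) ^ 2 ∣ p := by
    have := h4.mul_left ((-1) ^ j)
    rwa [← mul_assoc, ← mul_pow, neg_one_mul, neg_neg, one_pow, one_mul] at this
  have h6 : p ^ 2 ∣ p := by exact_mod_cast h5
  have := Nat.le_of_dvd hp.pos h6
  nlinarith [hp.two_le]

theorem exists_re_pow_eq_mul_odd (hε : ε.norm = 1) (heven : Even ε.re) {k : ℕ} (hk : Odd k) :
    ∃ h : ℤ, (ε ^ k).re = ε.re * h ∧ Odd h := by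
  obtain ⟨j, rfl⟩ := hk
  obtain ⟨h, t, e, f⟩ := exists_re_pow_odd_eq hε j
  refine ⟨h, e, ?_⟩
  have hodd : Odd ((-1 : ℤ) ^ j * (2 * j + 1)) := (odd_neg_one.pow).mul ⟨j, rfl⟩
  rw [f]
  exact hodd.add_even ((heven.pow_of_ne_zero two_ne_zero).mul_right _)

/-- Odd powers `k > 1` of a norm-one element with positive even real part admit an odd primitive
prime divisor of their real part. -/
theorem exists_primitive_prime_dvd_re_pow (hε : ε.norm = 1) (hre : 2 ≤ ε.re) (heven : Even ε.re)
    {k : ℕ} (hk : Odd k) (hk1 : 1 < k) :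
    ∃ p : ℕ, p.Prime ∧ Odd p ∧ (p : ℤ) ∣ (ε ^ k).re ∧
      ∀ j, 0 < j → j < k → ¬ (p : ℤ) ∣ (ε ^ j).re := by
  set N := (aeval ε (cyclotomic (4 * k) ℤ)).norm with hN
  have hdvd : ∀ {k' h}, k' ∣ k → k' < k → (ε ^ k').re ≠ 0 → (ε ^ k).re = (ε ^ k').re * h →
      N ∣ h ^ 2 := by
    intro k' h h1 h2 h3 h4
    have := norm_cyclotomic_mul_re_pow_sq_dvd hε hk h1 h2
    rw [h4, mul_pow, mul_comm] at this
    exact (mul_dvd_mul_iff_left (pow_ne_zero 2 h3)).1 this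
  have hNre : N ∣ (ε ^ k).re ^ 2 :=
    dvd_of_mul_right_dvd (norm_cyclotomic_mul_re_pow_sq_dvd hε hk (one_dvd k) hk1)
  have hoddN : Odd N := by
    obtain ⟨h, e, hodd⟩ := exists_re_pow_eq_mul_odd hε heven hk
    have hN2 : N ∣ h ^ 2 := hdvd (one_dvd k) hk1 (by rw [pow_one]; omega) (by rw [pow_one, e])
    rw [← Int.not_even_iff_odd, even_iff_two_dvd]
    exact fun h2 => Int.not_even_iff_odd.2 (hodd.pow (n := 2))
      (even_iff_two_dvd.2 (h2.trans hN2))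
  have hsize : (k : ℤ) ^ 2 < |N| := by
    have h1 := le_abs_norm_cyclotomic hε (by omega) (n := 4 * k) (by omega)
    have hcop : Nat.Coprime 2 k := Nat.coprime_two_left.2 hk
    have h2 : (4 * k).totient = k.totient * 2 := by
      rw [Nat.totient_mul (hcop.pow_left 2 : Nat.Coprime (2 ^ 2) k), mul_comm]; rfl
    -- By Euler, the odd number k divides 2^φ(k) - 1.
    have h3 : k < 2 ^ k.totient := by
      have h := Nat.ModEq.pow_totient hcop
      have hpos : 0 < k.totient := Nat.totient_pos.2 (by omega)
      have h' := (Nat.modEq_iff_dvd' Nat.one_le_two_pow).1 h.symm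
      have h2 : 2 ≤ 2 ^ k.totient := by simpa using Nat.pow_le_pow_right (n := 2) (by norm_num) hpos
      have := Nat.le_of_dvd (by omega) h'
      omega
    have h4 : (k : ℤ) < 2 ^ k.totient := by exact_mod_cast h3
    calc (k : ℤ) ^ 2 < (2 ^ k.totient) ^ 2 := by gcongr
      _ = 2 ^ (4 * k).totient := by rw [h2, pow_mul]
      _ ≤ (2 * ε.re - 2) ^ (4 * k).totient := by gcongr; omega
      _ ≤ |N| := h1
  -- Otherwise every prime of N divides k. Each occurs in N at most twice, because N divides the
  -- square of a cofactor not divisible by p², so N divides k², against `hsize`.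
  have hexists : ∃ p : ℕ, p.Prime ∧ (p : ℤ) ∣ N ∧ ¬ p ∣ k := by
    by_contra! hcon
    have hN0 : N.natAbs ≠ 0 := by
      intro h0
      rw [Int.natAbs_eq_zero] at h0
      rw [h0] at hoddN
      exact absurd hoddN (by decide)
    have hdiv : N.natAbs ∣ k ^ 2 := by
      rw [← Nat.factorization_le_iff_dvd hN0 (by positivity)]
      intro p
      by_cases hp : p.Prime
      swap; · simp [Nat.factorization_eq_zero_of_not_prime _ hp]
      by_cases hpN : p ∣ N.natAbs
      swap; · simp [Nat.factorization_eq_zero_of_not_dvd hpN]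
      have hpN' : (p : ℤ) ∣ N := Int.natCast_dvd.2 hpN
      have hpk := hcon p hp hpN'
      have h1 : 1 ≤ k.factorization p := (hp.dvd_iff_one_le_factorization (by omega)).1 hpk
      have h2 : N.natAbs.factorization p ≤ 2 := by
        obtain ⟨k', rfl⟩ := hpk
        obtain ⟨hpo, hk'⟩ := Nat.odd_mul.1 hk
        obtain ⟨h, e, hh⟩ := not_sq_dvd_cofactor hp hpo (norm_pow_eq_one hε k')
        have hre0 : (ε ^ (p * k')).re ≠ 0 := by
          obtain ⟨h', e', hodd'⟩ := exists_re_pow_eq_mul_odd hε heven hk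
          rw [e']
          refine mul_ne_zero (by omega) ?_
          rintro rfl
          exact absurd hodd' (by decide)
        rw [← pow_mul, mul_comm k' p] at e
        have hre0' : (ε ^ k').re ≠ 0 := fun h0 => hre0 (by rw [e, h0, zero_mul])
        have hh0 : h ≠ 0 := fun h0 => hre0 (by rw [e, h0, mul_zero])
        have hk'0 : 0 < k' := by rcases hk' with ⟨_, rfl⟩; omega
        have hNh := hdvd (dvd_mul_left k' p) (by nlinarith [hp.two_le]) hre0' e
        have h3 : h.natAbs.factorization p ≤ 1 := by
          by_contra! hlt
          apply hh
          have := (hp.pow_dvd_iff_le_factorization (Int.natAbs_ne_zero.2 hh0)).2 hlt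
          have := Int.natCast_dvd.2 this
          exact_mod_cast this
        have h4 : N.natAbs ∣ h.natAbs ^ 2 := by
          rw [← Int.natAbs_pow]; exact Int.natAbs_dvd_natAbs.2 hNh
        have h5 := (Nat.factorization_le_iff_dvd hN0
          (pow_ne_zero 2 (Int.natAbs_ne_zero.2 hh0))).2 h4 p
        simp only [Nat.factorization_pow, Finsupp.smul_apply, smul_eq_mul] at h5
        omega
      simp only [Nat.factorization_pow, Finsupp.smul_apply, smul_eq_mul]
      omega
    have := Nat.le_of_dvd (by positivity) hdiv
    rw [Int.abs_eq_natAbs] at hsize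
    have h' : k ^ 2 < N.natAbs := by exact_mod_cast hsize
    omega
  obtain ⟨p, hp, hpN, hpk⟩ := hexists
  have hpodd : Odd p := by
    rw [← Nat.not_even_iff_odd, even_iff_two_dvd]
    intro h2
    exact Int.not_even_iff_odd.2 hoddN
      (even_iff_two_dvd.2 ((Int.natCast_dvd_natCast.2 h2).trans hpN))
  refine ⟨p, hp, hpodd, ?_, fun j hj0 hjk => ?_⟩
  · exact (Nat.prime_iff_prime_int.1 hp).dvd_of_dvd_pow (hpN.trans hNre)
  · refine not_dvd_re_pow_of_dvd_norm_cyclotomic hε hp ?_ hpN hj0 hjk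
    intro h
    rcases hp.dvd_mul.1 h with h | h
    · have : p ∣ 2 := hp.dvd_of_dvd_pow (show p ∣ 2 ^ 2 from h)
      rw [(Nat.prime_dvd_prime_iff_eq hp Nat.prime_two).1 this] at hpodd
      exact absurd hpodd (by decide)
    · exact hpk h

end Zsqrtd

/-! ### Integrality and primes in the denominators -/

/-- If `z + z⁻¹ = 2 / n`, then `n ^ c * (z ^ c + z ^ (-c))` is an integer congruent to `2 ^ c`
modulo `n` for `c ≥ 1`. -/
theorem exists_int_pow_mul_pow_add_inv_pow {n : ℤ} (hn : n ≠ 0) {z : ℂ} (hz0 : z ≠ 0)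
    (hz : z + z⁻¹ = 2 / n) (c : ℕ) :
    ∃ V : ℤ, (n : ℂ) ^ (c + 1) * (z ^ (c + 1) + z⁻¹ ^ (c + 1)) = V ∧ n ∣ V - 2 ^ (c + 1) := by
  have hn' : (n : ℂ) ≠ 0 := by exact_mod_cast hn
  have hzn : (n : ℂ) * (z + z⁻¹) = 2 := by rw [hz]; field_simp
  have hzz : z * z⁻¹ = 1 := mul_inv_cancel₀ hz0
  generalize z⁻¹ = w at *
  induction c using Nat.twoStepInduction with
  | zero => exact ⟨2, by simpa using hzn, by simp⟩
  | one =>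
    refine ⟨4 - 2 * n ^ 2, ?_, ⟨-2 * n, by ring⟩⟩
    push_cast
    linear_combination (n * (z + w) + 2) * hzn - 2 * (n : ℂ) ^ 2 * hzz
  | more c ih₁ ih₂ =>
    obtain ⟨V₁, e₁, -⟩ := ih₁
    obtain ⟨V₂, e₂, t, ht⟩ := ih₂
    refine ⟨2 * V₂ - n ^ 2 * V₁, ?_, ⟨2 * t - n * V₁, by linear_combination 2 * ht⟩⟩
    push_cast
    rw [← e₁, ← e₂]
    linear_combination (n : ℂ) ^ (c + 2) * (z ^ (c + 2) + w ^ (c + 2)) * hzn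
      - (n : ℂ) ^ (c + 3) * (z ^ (c + 1) + w ^ (c + 1)) * hzz

theorem isIntegral_intCast_mul {n : ℤ} (hn : n ≠ 0) {z : ℂ} (hz0 : z ≠ 0)
    (hz : z + z⁻¹ = 2 / n) : IsIntegral ℤ ((n : ℂ) * z) := by
  have hn' : (n : ℂ) ≠ 0 := by exact_mod_cast hn
  refine ⟨X ^ 2 - C 2 * X + C (n ^ 2), by monicity!, ?_⟩
  rw [← aeval_def]
  have hzn : (n : ℂ) * (z + z⁻¹) = 2 := by rw [hz]; field_simp
  have hzz : z * z⁻¹ = 1 := mul_inv_cancel₀ hz0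
  simp only [map_add, map_sub, map_mul, map_pow, aeval_X, eq_intCast, map_intCast,
    map_ofNat]
  linear_combination n * z * hzn - (n : ℂ) ^ 2 * hzz

theorem isIntegral_pow_natAbs_mul_zpow {n : ℤ} (hn : n ≠ 0) {z : ℂ} (hz0 : z ≠ 0)
    (hz : z + z⁻¹ = 2 / n) (e : ℤ) : IsIntegral ℤ ((n : ℂ) ^ e.natAbs * z ^ e) := by
  rcases Int.natAbs_eq e with h | h
  · have := (isIntegral_intCast_mul hn hz0 hz).pow e.natAbs
    rw [mul_pow, ← zpow_natCast z, ← h] at this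
    exact this
  · have hz' : z⁻¹ + z⁻¹⁻¹ = 2 / n := by rw [inv_inv, add_comm, hz]
    have := (isIntegral_intCast_mul hn (inv_ne_zero hz0) hz').pow e.natAbs
    rw [mul_pow, inv_pow, ← zpow_natCast z, ← zpow_neg, ← h] at this
    exact this

variable {ι : Type*}

/-- A multiplicative relation between numbers `z i` with `z i + (z i)⁻¹ = 2 / n i` cannot involve
`z i₀` if `n i₀` has an odd prime factor that divides no other `n i`. -/
theorem exponent_eq_zero_of_prime_dvd [DecidableEq ι] {s : Finset ι} {n : ι → ℤ} {z : ι → ℂ}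
    {c : ι → ℤ}
    (hn : ∀ i ∈ s, n i ≠ 0) (hz0 : ∀ i ∈ s, z i ≠ 0) (hz : ∀ i ∈ s, z i + (z i)⁻¹ = 2 / n i)
    (hrel : ∏ i ∈ s, z i ^ c i = 1) {i₀ : ι} (hi₀ : i₀ ∈ s) {p : ℕ} (hp : p.Prime) (hodd : Odd p)
    (hpi : (p : ℤ) ∣ n i₀) (hpj : ∀ j ∈ s, j ≠ i₀ → ¬ (p : ℤ) ∣ n j) : c i₀ = 0 := by
  by_contra hc
  have hpZ : Prime (p : ℤ) := Nat.prime_iff_prime_int.1 hp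
  set t := s.erase i₀ with ht
  have hts : ∀ j ∈ t, j ∈ s := fun j hj => Finset.mem_of_mem_erase hj
  set M : ℤ := ∏ j ∈ t, n j ^ (c j).natAbs with hM
  rw [← Finset.mul_prod_erase s _ hi₀, ← ht] at hrel
  have hA0 : z i₀ ^ c i₀ ≠ 0 := zpow_ne_zero _ (hz0 i₀ hi₀)
  -- The relation writes this power of `z i₀` through the other factors, whose denominators M
  -- clears; p does not divide M.
  have h1 : IsIntegral ℤ ((M : ℂ) * z i₀ ^ (-c i₀)) := by
    have : (M : ℂ) * z i₀ ^ (-c i₀) = ∏ j ∈ t, ((n j : ℂ) ^ (c j).natAbs * z j ^ c j) := by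
      rw [Finset.prod_mul_distrib, hM, zpow_neg, ← eq_inv_of_mul_eq_one_right hrel]
      push_cast; rfl
    rw [this]
    exact IsIntegral.prod _ fun j hj =>
      isIntegral_pow_natAbs_mul_zpow (hn j (hts j hj)) (hz0 j (hts j hj)) (hz j (hts j hj)) _
  have h2 : IsIntegral ℤ ((M : ℂ) * z i₀ ^ c i₀) := by
    have : (M : ℂ) * z i₀ ^ c i₀ = ∏ j ∈ t, ((n j : ℂ) ^ (-c j).natAbs * z j ^ (-c j)) := by
      simp only [Finset.prod_mul_distrib, zpow_neg, Finset.prod_inv_distrib, Int.natAbs_neg]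
      rw [← eq_inv_of_mul_eq_one_left hrel, hM]
      push_cast; rfl
    rw [this]
    exact IsIntegral.prod _ fun j hj =>
      isIntegral_pow_natAbs_mul_zpow (hn j (hts j hj)) (hz0 j (hts j hj)) (hz j (hts j hj)) _
  obtain ⟨b, hb⟩ : ∃ b : ℕ, (c i₀).natAbs = b + 1 :=
    Nat.exists_eq_succ_of_ne_zero (Int.natAbs_ne_zero.2 hc)
  have hsum : z i₀ ^ c i₀ + z i₀ ^ (-c i₀) = z i₀ ^ (b + 1) + (z i₀)⁻¹ ^ (b + 1) := by
    rw [← hb, inv_pow, ← zpow_natCast, ← zpow_neg]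
    rcases Int.natAbs_eq (c i₀) with h | h
    · rw [← h]
    · rw [← neg_eq_iff_eq_neg.2 h, neg_neg, add_comm]
  obtain ⟨V, hV, hV2⟩ := exists_int_pow_mul_pow_add_inv_pow (hn i₀ hi₀) (hz0 i₀ hi₀) (hz i₀ hi₀) b
  have hn0 : (n i₀ : ℂ) ≠ 0 := by exact_mod_cast hn i₀ hi₀
  have hint := h2.add h1
  rw [← mul_add, hsum] at hint
  -- An integral rational number is an integer, so n^(b+1) divides MV. Since V ≡ 2^(b+1) mod n, the
  -- odd prime p can divide neither M nor V.
  obtain ⟨K, hK⟩ := hint.exists_int_iff_exists_rat.1 ⟨M * V / n i₀ ^ (b + 1), by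
    push_cast
    rw [← hV]
    field_simp⟩
  have hMV : M * V = n i₀ ^ (b + 1) * K := by
    have : (M * V : ℂ) = n i₀ ^ (b + 1) * K := by rw [← hV, ← hK]; ring
    exact_mod_cast this
  have hpMV : (p : ℤ) ∣ M * V := hMV ▸ (hpi.trans (dvd_pow_self _ (Nat.succ_ne_zero b))).mul_right _
  rcases hpZ.dvd_or_dvd hpMV with h | h
  · obtain ⟨j, hj, hpj'⟩ := (hpZ.dvd_finsetProd_iff _).1 h
    exact hpj j (hts j hj) (Finset.ne_of_mem_erase hj) (hpZ.dvd_of_dvd_pow hpj')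
  · have h2 : (p : ℤ) ∣ 2 ^ (b + 1) := by
      have := dvd_sub h (hpi.trans hV2)
      rwa [sub_sub_cancel] at this
    have h3 : p ∣ 2 := by exact_mod_cast hpZ.dvd_of_dvd_pow h2
    rw [(Nat.prime_dvd_prime_iff_eq hp Nat.prime_two).1 h3] at hodd
    exact absurd hodd (by decide)

/-! ### Galois averaging over a square class -/

/-- Given square roots `w i` of integers `1 - n i ^ 2` in a finite Galois extension of `ℚ`, a
multiplicative relation between the numbers `(1 + w i) / n i` yields one between those for which
`w i` lies in a fixed quadratic field. -/
theorem exists_relation_of_isGalois {L : Type*} [Field L] [Algebra ℚ L] [FiniteDimensional ℚ L]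
    [IsGalois ℚ L] {s : Finset ι} {n : ι → ℤ} {w : ι → L} {c : ι → ℤ}
    (hn : ∀ i, 1 < n i) (hw : ∀ i, w i ^ 2 = 1 - (n i : L) ^ 2)
    (hrel : ∏ i ∈ s, ((1 + w i) / n i) ^ c i = 1) {i₀ : ι} (hi₀ : i₀ ∈ s) :
    ∃ t ⊆ s, i₀ ∈ t ∧ (∀ i ∈ t, IsSquare ((n i ^ 2 - 1) * (n i₀ ^ 2 - 1))) ∧
      ∃ N : ℤ, N ≠ 0 ∧ ∏ i ∈ t, ((1 + w i) / n i) ^ (c i * N) = 1 := by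
  classical
  have : CharZero L := algebraRat.charZero L
  have hw0 : ∀ i, w i ≠ 0 := fun i h => by
    have h1 := hw i
    have h2 : (n i ^ 2 : ℤ) = 1 := by
      have : (n i : L) ^ 2 = 1 := by rw [h] at h1; linear_combination h1
      exact_mod_cast this
    nlinarith [hn i]
  have hn0 : ∀ i, (n i : L) ≠ 0 := fun i => by
    have := hn i
    exact_mod_cast (by omega : n i ≠ 0)
  have hconj : ∀ i, ((1 + w i) / n i)⁻¹ = (1 - w i) / n i := fun i => by
    have h1 : ((1 + w i) / n i) * ((1 - w i) / n i) = 1 := by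
      have := hn0 i
      field_simp
      linear_combination -hw i
    exact (eq_inv_of_mul_eq_one_right h1).symm
  have hsign : ∀ i (σ : L ≃ₐ[ℚ] L), ∃ e : ℤ, (e = 1 ∨ e = -1) ∧ σ (w i) = e * w i := by
    intro i σ
    have : σ (w i) ^ 2 = w i ^ 2 := by rw [← map_pow, hw]; simp
    rcases sq_eq_sq_iff_eq_or_eq_neg.1 this with h | h
    · exact ⟨1, Or.inl rfl, by simp [h]⟩
    · exact ⟨-1, Or.inr rfl, by simp [h]⟩
  choose χ hχ hχw using hsign
  have hmul : ∀ i σ τ, χ i (σ * τ) = χ i σ * χ i τ := by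
    intro i σ τ
    have h1 : ((χ i (σ * τ) : ℤ) : L) * w i = (χ i σ * χ i τ : ℤ) * w i := by
      rw [← hχw, AlgEquiv.mul_apply, hχw, map_mul, map_intCast, hχw]
      push_cast; ring
    exact_mod_cast mul_right_cancel₀ (hw0 i) h1
  have hz : ∀ i σ, σ ((1 + w i) / n i) = ((1 + w i) / n i) ^ χ i σ := by
    intro i σ
    rcases hχ i σ with h | h
    · rw [h, zpow_one, map_div₀, map_add, map_one, hχw, h]; simp
    · rw [h, zpow_neg_one, hconj, map_div₀, map_add, map_one, hχw, h]; simp; ring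
  have hz0 : ∀ i, (1 + w i) / n i ≠ 0 := fun i h => by
    have := hconj i
    rw [h, inv_zero] at this
    have h1 : (1 + w i) = 0 := (div_eq_zero_iff.1 h).resolve_right (hn0 i)
    have h2 : (1 - w i) = 0 := (div_eq_zero_iff.1 this.symm).resolve_right (hn0 i)
    have h3 : (2 : L) = 0 := by linear_combination h1 + h2
    exact two_ne_zero h3
  -- Apply σ to the relation, raise it to the power `χ i₀ σ`, and multiply over all σ. Orthogonality
  -- of characters then kills the exponents with `χ i ≠ χ i₀`.
  have hprod : ∏ i ∈ s, ((1 + w i) / n i) ^ (c i * ∑ σ : L ≃ₐ[ℚ] L, χ i σ * χ i₀ σ) = 1 := by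
    have h1 : ∀ σ : L ≃ₐ[ℚ] L, ∏ i ∈ s, ((1 + w i) / n i) ^ (c i * (χ i σ * χ i₀ σ)) = 1 := by
      intro σ
      have := congrArg (fun x => x ^ χ i₀ σ) (congrArg σ hrel)
      simp only [map_prod, map_zpow₀, map_one, one_zpow, hz, ← Finset.prod_zpow, ← zpow_mul] at this
      refine (Finset.prod_congr rfl fun i _ => ?_).trans this
      congr 1; ring
    have h2 : ∀ i ∈ s, ((1 + w i) / n i) ^ (c i * ∑ σ : L ≃ₐ[ℚ] L, χ i σ * χ i₀ σ) =
        ∏ σ : L ≃ₐ[ℚ] L, ((1 + w i) / n i) ^ (c i * (χ i σ * χ i₀ σ)) := by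
      intro i _
      rw [Finset.mul_sum]
      generalize (Finset.univ : Finset (L ≃ₐ[ℚ] L)) = U
      induction U using Finset.induction_on with
      | empty => simp
      | insert a U ha ih => rw [Finset.sum_insert ha, Finset.prod_insert ha, zpow_add₀ (hz0 i), ih]
    rw [Finset.prod_congr rfl h2, Finset.prod_comm]
    exact Finset.prod_eq_one fun σ _ => h1 σ
  let P : ι → Prop := fun i => ∀ σ, χ i σ * χ i₀ σ = 1
  have hP0 : ∀ i, ¬ P i → ∑ σ : L ≃ₐ[ℚ] L, χ i σ * χ i₀ σ = 0 := by
    intro i hi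
    simp only [P, not_forall] at hi
    obtain ⟨τ, hτ⟩ := hi
    have hτ' : χ i τ * χ i₀ τ = -1 := by
      rcases hχ i τ with h | h <;> rcases hχ i₀ τ with h' | h' <;> simp [h, h'] at hτ ⊢
    have h1 : ∑ σ : L ≃ₐ[ℚ] L, χ i σ * χ i₀ σ = ∑ σ : L ≃ₐ[ℚ] L, χ i (τ * σ) * χ i₀ (τ * σ) :=
      (Equiv.sum_comp (Equiv.mulLeft τ) fun σ => χ i σ * χ i₀ σ).symm
    have h2 : ∑ σ : L ≃ₐ[ℚ] L, χ i (τ * σ) * χ i₀ (τ * σ) =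
        -∑ σ : L ≃ₐ[ℚ] L, χ i σ * χ i₀ σ := by
      rw [← Finset.sum_neg_distrib]
      refine Finset.sum_congr rfl fun σ _ => ?_
      rw [hmul, hmul]
      linear_combination χ i σ * χ i₀ σ * hτ'
    omega
  refine ⟨s.filter P, Finset.filter_subset _ _, ?_, ?_, Fintype.card (L ≃ₐ[ℚ] L), ?_, ?_⟩
  · refine Finset.mem_filter.2 ⟨hi₀, fun σ => ?_⟩
    rcases hχ i₀ σ with h | h <;> simp [h]
  · intro i hi
    have hPi := (Finset.mem_filter.1 hi).2
    -- Equal characters make this product Galois-invariant, hence rational; its square is the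
    -- integer in question.
    have hfix : w i * w i₀ ∈ (⊥ : IntermediateField ℚ L) := by
      rw [IsGalois.mem_bot_iff_fixed]
      intro σ
      have h1 : ((χ i σ * χ i₀ σ : ℤ) : L) = 1 := by rw [hPi σ]; simp
      push_cast at h1
      rw [map_mul, hχw, hχw]
      linear_combination w i * w i₀ * h1
    obtain ⟨q, hq⟩ := IntermediateField.mem_bot.1 hfix
    rw [← Rat.isSquare_intCast_iff]
    refine ⟨q, ?_⟩
    have h2 : (((((n i ^ 2 - 1) * (n i₀ ^ 2 - 1) : ℤ) : ℚ)) : L) = ((q * q : ℚ) : L) := by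
      rw [eq_ratCast] at hq
      push_cast
      rw [hq]
      linear_combination (-(1 - (n i₀ : L) ^ 2)) * hw i - w i ^ 2 * hw i₀
    exact_mod_cast h2
  · exact_mod_cast Fintype.card_ne_zero
  · rw [Finset.prod_filter]
    refine (Finset.prod_congr rfl fun i _ => ?_).trans hprod
    split_ifs with h
    · rw [Finset.sum_congr rfl fun σ _ => h σ]; simp
    · rw [hP0 i h, mul_zero, zpow_zero]

/-- A multiplicative relation between complex numbers `z i` with `z i + (z i)⁻¹ = 2 / n i` yields
one between those whose `n i ^ 2 - 1` lie in a fixed square class. -/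
theorem exists_relation_same_square_class [Fintype ι] {s : Finset ι} {n : ι → ℤ} {z : ι → ℂ} {c : ι → ℤ}
    (hn : ∀ i, 1 < n i) (hz0 : ∀ i, z i ≠ 0) (hz : ∀ i, z i + (z i)⁻¹ = 2 / n i)
    (hrel : ∏ i ∈ s, z i ^ c i = 1) {i₀ : ι} (hi₀ : i₀ ∈ s) :
    ∃ t ⊆ s, i₀ ∈ t ∧ (∀ i ∈ t, IsSquare ((n i ^ 2 - 1) * (n i₀ ^ 2 - 1))) ∧
      ∃ N : ℤ, N ≠ 0 ∧ ∏ i ∈ t, z i ^ (c i * N) = 1 := by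
  have hn0 : ∀ i, (n i : ℂ) ≠ 0 := fun i => by
    have := hn i
    exact_mod_cast (by omega : n i ≠ 0)
  have hsq : ∀ i, (n i * z i - 1) ^ 2 = 1 - (n i : ℂ) ^ 2 := fun i => by
    have hzn : (n i : ℂ) * (z i + (z i)⁻¹) = 2 := by
      have := hn0 i
      rw [hz]; field_simp
    linear_combination n i * z i * hzn - (n i : ℂ) ^ 2 * mul_inv_cancel₀ (hz0 i)
  let f : ℚ[X] := ∏ i, (X ^ 2 - C (1 - (n i : ℚ) ^ 2))
  have hf : f ≠ 0 := Finset.prod_ne_zero_iff.2 fun i _ => X_pow_sub_C_ne_zero (by norm_num) _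
  have hroot : ∀ i, (n i * z i - 1 : ℂ) ∈ f.rootSet ℂ := by
    intro i
    rw [mem_rootSet]
    refine ⟨hf, ?_⟩
    simp only [f, map_prod]
    refine Finset.prod_eq_zero (Finset.mem_univ i) ?_
    simp [hsq i]
  let L := IntermediateField.adjoin ℚ (f.rootSet ℂ)
  have : f.IsSplittingField ℚ L :=
    IntermediateField.adjoin_rootSet_isSplittingField (IsAlgClosed.splits _)
  have : FiniteDimensional ℚ L := IsSplittingField.finiteDimensional L f
  have : Normal ℚ L := Normal.of_isSplittingField f
  have : IsGalois ℚ L := {}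
  let w : ι → L := fun i => ⟨n i * z i - 1, IntermediateField.subset_adjoin ℚ _ (hroot i)⟩
  have hwz : ∀ i, (((1 + w i) / n i : L) : ℂ) = z i := fun i => by
    have := hn0 i
    push_cast
    simp only [w]
    field_simp
    ring
  have hw : ∀ i, w i ^ 2 = 1 - (n i : L) ^ 2 := fun i => by
    apply Subtype.ext
    push_cast
    exact hsq i
  have hrel' : ∏ i ∈ s, ((1 + w i) / n i) ^ c i = 1 := by
    apply (algebraMap L ℂ).injective
    rw [map_prod, map_one, ← hrel]
    refine Finset.prod_congr rfl fun i _ => ?_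
    rw [map_zpow₀]
    congr 1
    exact hwz i
  obtain ⟨t, hts, hit, hsquare, N, hN, hN'⟩ := exists_relation_of_isGalois hn hw hrel' hi₀
  refine ⟨t, hts, hit, hsquare, N, hN, ?_⟩
  have := congrArg (algebraMap L ℂ) hN'
  rw [map_prod, map_one] at this
  rw [← this]
  refine Finset.prod_congr rfl fun i _ => ?_
  rw [map_zpow₀]
  congr 1
  exact (hwz i).symm

/-! ### A square class as one Pell equation -/

theorem exists_eq_mul_sq_of_isSquare_mul {a b u : ℤ} (ha : Squarefree a) (hb : b ≠ 0)
    (h : IsSquare (u * (b ^ 2 * a))) : ∃ v, u = a * v ^ 2 := by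
  obtain ⟨y, hy⟩ := h
  have ha0 : a ≠ 0 := ha.ne_zero
  obtain ⟨y', rfl⟩ : b * a ∣ y := by
    have hbsq : b ^ 2 ∣ y ^ 2 := ⟨u * a, by linear_combination -hy⟩
    obtain ⟨y₁, rfl⟩ := (Int.pow_dvd_pow_iff two_ne_zero).1 hbsq
    have h1 : u * a = y₁ ^ 2 :=
      mul_left_cancel₀ (pow_ne_zero 2 hb) (by linear_combination hy)
    exact mul_dvd_mul_left b (ha.isRadical 2 y₁ ⟨u, by linear_combination -h1⟩)
  refine ⟨y', ?_⟩
  have h0 : b ^ 2 * a ≠ 0 := mul_ne_zero (pow_ne_zero 2 hb) ha0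
  exact mul_right_cancel₀ h0 (by linear_combination hy)

/-- Among distinct even integers `n i > 1` with `n i ^ 2 - 1` in a single square class, either there
is just one, or one of them has an odd prime factor dividing none of the others. -/
theorem exists_odd_prime_dvd_unique {t : Finset ι} {n : ι → ℤ} (hinj : Set.InjOn n t)
    (hn : ∀ i ∈ t, 1 < n i) (heven : ∀ i ∈ t, Even (n i)) {i₀ : ι} (hi₀ : i₀ ∈ t)
    (hsq : ∀ i ∈ t, IsSquare ((n i ^ 2 - 1) * (n i₀ ^ 2 - 1))) :
    ∃ i ∈ t, t = {i} ∨ ∃ p : ℕ, p.Prime ∧ Odd p ∧ (p : ℤ) ∣ n i ∧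
      ∀ j ∈ t, j ≠ i → ¬ (p : ℤ) ∣ n j := by
  -- The squarefree part d of n(i₀)² - 1 serves the whole class: each n(i)² - 1 is d times a square.
  obtain ⟨d, b, hdb, hd⟩ : ∃ d b : ℤ, b ^ 2 * d = n i₀ ^ 2 - 1 ∧ Squarefree d := by
    obtain ⟨d, b, h, hd⟩ := Nat.sq_mul_squarefree (n i₀ ^ 2 - 1).natAbs
    refine ⟨d, b, ?_, Int.squarefree_natCast.2 hd⟩
    have h1 : (((n i₀ ^ 2 - 1).natAbs : ℕ) : ℤ) = n i₀ ^ 2 - 1 :=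
      Int.natAbs_of_nonneg (by nlinarith [hn i₀ hi₀])
    rw [← h1, ← h]; push_cast; ring
  have hb : b ≠ 0 := by
    rintro rfl
    nlinarith [hn i₀ hi₀]
  have hsol : ∀ i ∈ t, ∃ a : Pell.Solution₁ d, a.x = n i ∧ 0 ≤ a.y := by
    intro i hi
    obtain ⟨v, hv⟩ := exists_eq_mul_sq_of_isSquare_mul hd hb (hdb ▸ hsq i hi)
    exact ⟨Pell.Solution₁.mk (n i) |v| (by rw [sq_abs]; linear_combination hv), by simp, by simp⟩
  obtain ⟨a₀, ha₀, -⟩ := hsol i₀ hi₀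
  have ha₀' : 1 < a₀.x := ha₀ ▸ hn i₀ hi₀
  obtain ⟨a, ha⟩ := Pell.IsFundamental.exists_of_not_isSquare
    (Pell.Solution₁.d_pos_of_one_lt_x ha₀')
    (Pell.Solution₁.d_nonsquare_of_one_lt_x ha₀')
  set ε : ℤ√d := a.1
  have hnorm : ε.norm = 1 := Zsqrtd.norm_eq_one_iff_mem_unitary.2 a.2
  have hεx : ε.re = a.x := rfl
  have hexp : ∀ i ∈ t, ∃ k : ℕ, n i = (ε ^ k).re := by
    intro i hi
    obtain ⟨u, hu, huy⟩ := hsol i hi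
    obtain ⟨k, rfl⟩ := ha.eq_pow_of_nonneg (by rw [hu]; linarith [hn i hi]) huy
    exact ⟨k, by rw [← hu]; rfl⟩
  choose! k hk using hexp
  have hodd : ∀ i ∈ t, Odd (k i) := by
    intro i hi
    rw [← Nat.not_even_iff_odd]
    rintro ⟨l, hl⟩
    have h1 := heven i hi
    rw [hk i hi, hl, ← two_mul, ← Int.not_odd_iff_even] at h1
    exact h1 (Zsqrtd.odd_re_pow_two_mul hnorm l)
  have heven' : Even ε.re := by
    obtain ⟨l, hl⟩ := hodd i₀ hi₀
    have h1 := heven i₀ hi₀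
    rw [hk i₀ hi₀, hl] at h1
    exact Zsqrtd.even_re_of_even_re_pow hnorm l h1
  -- A prime primitive for the largest exponent divides none of the other n. If that exponent is 1,
  -- all exponents are 1 and the class is a single element.
  obtain ⟨i, hi, hmax⟩ := Finset.exists_max_image t k ⟨i₀, hi₀⟩
  refine ⟨i, hi, ?_⟩
  have hkinj : ∀ j ∈ t, k j = k i → j = i := fun j hj h =>
    hinj hj hi (by rw [hk j hj, hk i hi, h])
  have hpos : ∀ j ∈ t, 0 < k j := fun j hj => (hodd j hj).pos
  rcases Nat.lt_or_ge 1 (k i) with h1 | h1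
  · right
    obtain ⟨p, hp, hpodd, hpi, hpj⟩ :=
      Zsqrtd.exists_primitive_prime_dvd_re_pow hnorm (hεx ▸ ha.1) heven' (hodd i hi) h1
    refine ⟨p, hp, hpodd, by rwa [hk i hi], fun j hj hji => ?_⟩
    rw [hk j hj]
    exact hpj _ (hpos j hj) (lt_of_le_of_ne (hmax j hj) fun h => hji (hkinj j hj h))
  · left
    refine Finset.eq_singleton_iff_unique_mem.2 ⟨hi, fun j hj => hkinj j hj ?_⟩
    have := hpos j hj
    have := hmax j hj
    have := hpos i hi
    omega

/-! ### Multiplicative independence of the exponentials -/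

theorem exp_arccos_add_inv {n : ℤ} (hn : 1 < n) :
    Complex.exp (Real.arccos (1 / n) * Complex.I) +
      (Complex.exp (Real.arccos (1 / n) * Complex.I))⁻¹ = 2 / n := by
  have hn' : (1 : ℝ) < n := by exact_mod_cast hn
  have h1 : Real.cos (Real.arccos (1 / n)) = 1 / n :=
    Real.cos_arccos (by linarith [show (0 : ℝ) < 1 / n by positivity])
      ((div_le_one (by linarith)).2 hn'.le)
  have h2 := Complex.two_cos (x := (Real.arccos (1 / n) : ℂ))
  rw [← Complex.ofReal_cos, h1] at h2
  rw [← Complex.exp_neg, ← neg_mul, ← h2]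
  push_cast
  ring

/-- `arccos (1 / n)` is not a rational multiple of `π` for `n ≥ 3`. -/
theorem exponent_eq_zero_of_exp_arccos_zpow_eq_one {n : ℤ} (hn : 2 < n) {c : ℤ}
    (h : Complex.exp (Real.arccos (1 / n) * Complex.I) ^ c = 1) : c = 0 := by
  by_contra hc
  have hn' : (2 : ℝ) < n := by exact_mod_cast hn
  have hpos : (0 : ℝ) < 1 / n := by positivity
  have hlt : 1 / (n : ℝ) < 1 / 2 := one_div_lt_one_div_of_lt two_pos hn'
  have hcos : Real.cos (Real.arccos (1 / n)) = 1 / n :=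
    Real.cos_arccos (by linarith) (by linarith)
  rw [← Complex.exp_int_mul, Complex.exp_eq_one_iff] at h
  obtain ⟨m, hm⟩ := h
  have hm' : (c : ℝ) * Real.arccos (1 / n) = m * (2 * Real.pi) := by
    have := mul_right_cancel₀ Complex.I_ne_zero
      (show ((c * Real.arccos (1 / n) : ℝ) : ℂ) * Complex.I =
          ((m * (2 * Real.pi) : ℝ) : ℂ) * Complex.I by
        push_cast at hm ⊢; linear_combination hm)
    exact_mod_cast this
  have hc' : (c : ℝ) ≠ 0 := by exact_mod_cast hc
  have := niven (θ := Real.arccos (1 / n))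
    ⟨2 * m / c, by push_cast; field_simp; linear_combination hm'⟩
    ⟨1 / n, by rw [hcos]; push_cast; rfl⟩
  rw [hcos] at this
  simp only [Set.mem_insert_iff, Set.mem_singleton_iff] at this
  rcases this with h | h | h | h | h <;> linarith

/-- The numbers `exp (I * arccos (1 / n))`, for even `n ≥ 4`, are multiplicatively independent. -/
theorem exponents_eq_zero_of_prod_exp_arccos_eq_one [Fintype ι] {n : ι → ℤ}
    (hinj : Function.Injective n) (hn : ∀ i, 2 < n i) (heven : ∀ i, Even (n i)) {c : ι → ℤ}
    (hrel : ∏ i, Complex.exp (Real.arccos (1 / n i) * Complex.I) ^ c i = 1) (i₀ : ι) :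
    c i₀ = 0 := by
  classical
  by_contra hc
  have hrel' : ∏ i with c i ≠ 0, Complex.exp (Real.arccos (1 / n i) * Complex.I) ^ c i = 1 := by
    rw [Finset.prod_filter]
    refine (Finset.prod_congr rfl fun i _ => ?_).trans hrel
    split_ifs with h
    · rfl
    · rw [not_not.1 h, zpow_zero]
  have hn1 : ∀ i, 1 < n i := fun i => by linarith [hn i]
  obtain ⟨t, hts, hit, hsq, N, hN, hN'⟩ := exists_relation_same_square_class hn1
    (fun i => Complex.exp_ne_zero _) (fun i => exp_arccos_add_inv (hn1 i)) hrel'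
    (Finset.mem_filter.2 ⟨Finset.mem_univ i₀, hc⟩)
  obtain ⟨i, hi, h⟩ := exists_odd_prime_dvd_unique hinj.injOn (fun i _ => hn1 i)
    (fun i _ => heven i) hit hsq
  have hci : c i * N ≠ 0 := mul_ne_zero (Finset.mem_filter.1 (hts hi)).2 hN
  rcases h with rfl | ⟨p, hp, hodd, hpi, hpj⟩
  · rw [Finset.prod_singleton] at hN'
    exact hci (exponent_eq_zero_of_exp_arccos_zpow_eq_one (hn i) hN')
  · exact hci (exponent_eq_zero_of_prime_dvd (c := fun i => c i * N)
      (fun i _ => (zero_lt_one.trans (hn1 i)).ne') (fun i _ => Complex.exp_ne_zero _)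
      (fun i _ => exp_arccos_add_inv (hn1 i)) hN' hi hp hodd hpi hpj)

/-! ### Totients and linear independence -/

/-- An odd r divides 2^φ(r) - 1, so φ(r) = 2 would force r ≤ 3. -/
theorem two_lt_totient_of_odd {r : ℕ} (hr : Odd r) (h3 : 3 < r) : 2 < r.totient := by
  have h1 : r.totient ≠ 2 := by
    intro h
    have hcop : Nat.Coprime 2 r := Nat.coprime_two_left.2 hr
    have := (Nat.modEq_iff_dvd' Nat.one_le_two_pow).1 (Nat.ModEq.pow_totient hcop).symm
    rw [h] at this
    have := Nat.le_of_dvd (by norm_num) this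
    omega
  have h2 : Even r.totient := Nat.totient_even (by omega)
  have h4 : 0 < r.totient := Nat.totient_pos.2 (by omega)
  obtain ⟨l, hl⟩ := h2
  omega

theorem mainTheorem7 (P : Finset ℕ) (hP : ∀ p ∈ P, p.Prime ∧ Odd p)
    (m : ℕ) (hm : m = ∏ p ∈ P, p) :
    LinearIndepOn ℚ (id : ℝ → ℝ)
      ({Real.pi} ∪
        {x : ℝ | ∃ r : ℕ, r ∣ m ∧ 3 < r ∧ x = Real.arccos (1 / (Nat.totient r : ℝ))}) := by
  have hmodd : Odd m := by
    rw [hm]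
    exact Finset.prod_induction _ Odd (fun _ _ => Odd.mul) odd_one fun p hp => (hP p hp).2
  set S : Set ℝ := {x : ℝ | ∃ r : ℕ, r ∣ m ∧ 3 < r ∧ x = Real.arccos (1 / (Nat.totient r : ℝ))}
    with hS
  have hrep : ∀ x ∈ S, ∃ n : ℤ, 2 < n ∧ Even n ∧ x = Real.arccos (1 / n) := by
    rintro x ⟨r, hrm, hr3, rfl⟩
    have hrodd : Odd r := Odd.of_dvd_nat hmodd hrm
    refine ⟨r.totient, by exact_mod_cast two_lt_totient_of_odd hrodd hr3, ?_, by push_cast; rfl⟩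
    exact_mod_cast Nat.totient_even (by omega)
  rw [LinearIndepOn, ← LinearIndependent.iff_fractionRing ℤ ℚ, ← LinearIndepOn, linearIndepOn_iff']
  intro t g hts hg
  -- q is the coefficient of π, with value 0 when π does not occur.
  obtain ⟨q, hq, hsum⟩ : ∃ q : ℤ, (Real.pi ∈ t → q = g Real.pi) ∧
      ∑ x ∈ t.erase Real.pi, (g x : ℝ) * x = -q * Real.pi := by
    simp only [id, zsmul_eq_mul] at hg
    by_cases h : Real.pi ∈ t
    · rw [← Finset.add_sum_erase t _ h] at hg
      exact ⟨g Real.pi, fun _ => rfl, by linarith⟩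
    · exact ⟨0, fun h' => absurd h' h, by rw [Finset.erase_eq_of_notMem h, hg]; simp⟩
  have hmem : ∀ x : t.erase Real.pi, (x : ℝ) ∈ S := fun x =>
    (hts (Finset.mem_of_mem_erase x.2)).resolve_left (Finset.ne_of_mem_erase x.2)
  choose n hn2 hneven hnx using fun x : t.erase Real.pi => hrep x (hmem x)
  have hinj : Function.Injective n := fun x y h => Subtype.ext (by rw [hnx x, hnx y, h])
  -- The exponents are doubled so that the π term contributes exp(-2πiq) = 1.
  have hprod : ∏ x : t.erase Real.pi,
      Complex.exp (Real.arccos (1 / n x) * Complex.I) ^ (2 * g x) = 1 := by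
    have h1 : ∀ x : t.erase Real.pi, Complex.exp (Real.arccos (1 / n x) * Complex.I) ^ (2 * g x)
        = Complex.exp (2 * Complex.I * ((g x * x : ℝ) : ℂ)) := fun x => by
      rw [← hnx, ← Complex.exp_int_mul]
      congr 1; push_cast; ring
    rw [Finset.prod_congr rfl fun x _ => h1 x, ← Complex.exp_sum, ← Finset.mul_sum,
      ← Complex.ofReal_sum, Finset.sum_coe_sort (t.erase Real.pi) fun x => (g x : ℝ) * x, hsum,
      Complex.exp_eq_one_iff]
    exact ⟨-q, by push_cast; ring⟩
  have hzero : ∀ x ∈ t.erase Real.pi, g x = 0 := fun x hx => by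
    have := exponents_eq_zero_of_prod_exp_arccos_eq_one hinj hn2 hneven hprod ⟨x, hx⟩
    simpa using this
  intro x hx
  by_cases hxpi : x = Real.pi
  · subst hxpi
    rw [Finset.sum_eq_zero fun y hy => by rw [hzero y hy]; simp] at hsum
    have := (mul_eq_zero.1 hsum.symm).resolve_right Real.pi_ne_zero
    rw [← hq hx]
    exact_mod_cast neg_eq_zero.1 this
  · exact hzero x (Finset.mem_erase.2 ⟨hxpi, hx⟩)
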